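/- Let $N \ge 4$ probes $1,\dots,N$ be placed at points $p_1,\dots,p_N$ of the Euclidean plane (an infinite uniform isotropic sheet with sheet resistance $\rho>0$) such that no three of them are collinear. Probes $1,2,3$ are reference probes, whose positions are known. For distinct probes $a,b,c,d$ the four-probe measurement $(a,b,c,d)$ reads the resistance $$R^{ab}_{cd}=\frac{\rho}{2\pi}\ln\frac{\|p_b-p_d\|\,\|p_a-p_c\|}{\|p_a-p_b\|\,\|p_c-p_d\|}.$$ A pattern is a choice of $N$ distinct points $\hat p_1,\dots,\hat p_N$ of the plane with $\hat p_i=p_i$ for $i\le 3$. (1) There is a set $M$ of $2+3(N-4)$ four-probe measurements, depending on $N$ only, such that for all $\rho>0$ and all such positions $p_1,\dots,p_N$ the following holds. (a) Suppose that $\rho$ is known and, if $N\ge 6$, that $p_4$ does not lie on the circle through $p_1,p_2,p_3$. Then at most two patterns give, with the sheet resistance $\rho$, the measured resistances for all measurements in $M$. (b) Suppose that $\rho$ is unknown and $N\ge 5$. Then only finitely many pairs of a sheet resistance $\hat\rho>0$ and a pattern give the measured resistances for all measurements in $M$. (2) If $\rho$ is known, then without any condition on $p_4$ beyond the absence of three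 collinear probes, $2+3(N-4)$ measurements still suffice to leave at most two patterns, provided that each measurement may be chosen from the results of the earlier ones: for every $\rho>0$ there is a rule (depending on $N$ and $\rho$ only) that selects each measurement from the earlier readings, such that for all positions $p_1,\dots,p_N$ as above at most two patterns give the same sequence of $2+3(N-4)$ readings as $p_1,\dots,p_N$. -/

import Mathlib

/-- The surface of the (infinitely large) sheet: the Euclidean plane. -/
abbrev Sheet : Type := EuclideanSpace ℝ (Fin 2)

/-- A four-probe measurement on `N` probes: four distinct probes, in the roles
`q 0` (current in), `q 1` (voltage plus), `q 2` (voltage minus), `q 3` (current out). -/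
abbrev FourProbe (N : ℕ) : Type := Fin 4 ↪ Fin N

/-- The resistance `(ρ / 2π) ln (s_bd s_ac / (s_ab s_cd))` read in the four-probe measurement
`q = (a, b, c, d)`, for the sheet resistance `ρ` and the probe positions `P`, where `s_xy` is the
distance of the probes `x` and `y`. -/
noncomputable def resistance {N : ℕ} (ρ : ℝ) (P : Fin N → Sheet) (q : FourProbe N) : ℝ :=
  ρ / (2 * Real.pi) *
    Real.log ((dist (P (q 1)) (P (q 3)) * dist (P (q 0)) (P (q 2))) /
      (dist (P (q 0)) (P (q 1)) * dist (P (q 2)) (P (q 3))))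

/-- No three probes lie on a straight line. -/
def NoThreeCollinear {N : ℕ} (P : Fin N → Sheet) : Prop :=
  ∀ i j k : Fin N, i ≠ j → i ≠ k → j ≠ k → ¬ Collinear ℝ {P i, P j, P k}

/-- `Q` is an arrangement of `N` probes at distinct places that has its three reference probes
(those with the indices `0, 1, 2`) where `P` has them. -/
def IsPattern {N : ℕ} (P Q : Fin N → Sheet) : Prop :=
  Function.Injective Q ∧ ∀ i : Fin N, (i : ℕ) < 3 → Q i = P i

/-- The first `n` readings, the latest one first, when the next measurement is always chosen by
`S` from the list of the readings so far, and measurement `q` has the reading `R q`. -/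
def readings {N : ℕ} (S : List ℝ → FourProbe N) (R : FourProbe N → ℝ) : ℕ → List ℝ
  | 0 => []
  | n + 1 => R (S (readings S R n)) :: readings S R n

/-! Put `n = N - 4`. The Möbius map taking the reference probes to `0`, `1`, `∞` takes the new
probes to complex coordinates `z_j`, and a reading is the logarithm of the modulus of a cross ratio,
scaled by the sheet resistance. With the third reference probe at `∞`, suitable measurements read
`|z_j|`, `|z_j - 1|` and `|z_i - z_r| / |z_r|`. The first two kinds, `2(n + 1)` in number, fix each
`z_j` up to conjugation (`eq_or_eq_conj`). If one `z_r` is not real, its distances to the other `n`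
coordinates settle their conjugations relative to its own (`eq_of_three_norms`), so two patterns
remain at most.

The fixed set takes `r = 0`. A real `z_0` would put the first four probes on a circle, which is
excluded for `n ≥ 2` and harmless for `n ≤ 1`. The adaptive rule picks `r` after the first `2(n +
1)` readings, which reveal the real coordinates; if all are real, the pattern is unique.

For unknown `ρ`, a candidate `σ` replaces every distance by its power with exponent `s = ρ / σ`. The
Gram determinant of the planar points `0`, `1`, `z_0`, `z_i` must vanish. It is an exponential sum
in `s`, nonzero at `s = 0`, so only finitely many `s` survive (`finite_exponents`). -/

/-! ### Zeros of real exponential sums -/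

/-- If the derivative has finitely many zeros, so has the function. -/
theorem finite_zeros_of_deriv {g g' : ℝ → ℝ} (hg : ∀ s, HasDerivAt g (g' s) s)
    (h : {s | g' s = 0}.Finite) : {s | g s = 0}.Finite := by
  by_contra hinf
  -- Rolle with induction on the largest zero. The last clause keeps the zeros of `g'` found so far
  -- below the second largest zero of `g`, so the next one is new.
  have key : ∀ n : ℕ, ∀ t : Finset ℝ, (∀ s ∈ t, g s = 0) → t.card = n + 1 →
      ∃ u : Finset ℝ, u.card = n ∧ (∀ x ∈ u, g' x = 0) ∧ ∀ x ∈ u, ∃ y ∈ t, x < y := by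
    intro n
    induction n with
    | zero => intro t _ _; exact ⟨∅, by simp⟩
    | succ n ih =>
      intro t ht hc
      have hne : t.Nonempty := Finset.card_pos.mp (by omega)
      have hmem := t.max'_mem hne
      set m := t.max' hne with hm
      have hc' : (t.erase m).card = n + 1 := by rw [Finset.card_erase_of_mem hmem]; omega
      have hne' : (t.erase m).Nonempty := Finset.card_pos.mp (by omega)
      obtain ⟨u, hu, hu0, hut⟩ := ih (t.erase m) (fun s hs => ht s (Finset.mem_of_mem_erase hs)) hc'
      have hmem' := (t.erase m).max'_mem hne'
      set m' := (t.erase m).max' hne' with hm'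
      have hlt : m' < m := lt_of_le_of_ne (t.le_max' _ (Finset.mem_of_mem_erase hmem'))
        (Finset.ne_of_mem_erase hmem')
      obtain ⟨c, hcI, hc0⟩ := exists_hasDerivAt_eq_zero hlt
        (fun s _ => (hg s).continuousAt.continuousWithinAt)
        ((ht m' (Finset.mem_of_mem_erase hmem')).trans (ht m hmem).symm) (fun s _ => hg s)
      have hcu : c ∉ u := by
        intro hcu
        obtain ⟨y, hy, hcy⟩ := hut c hcu
        have := (t.erase m).le_max' y hy
        linarith [hcI.1]
      refine ⟨insert c u, by rw [Finset.card_insert_of_notMem hcu, hu], ?_, ?_⟩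
      · simp only [Finset.mem_insert, forall_eq_or_imp]
        exact ⟨hc0, hu0⟩
      · simp only [Finset.mem_insert, forall_eq_or_imp]
        exact ⟨⟨m, hmem, hcI.2⟩, fun x hx => let ⟨y, hy, hxy⟩ := hut x hx
          ⟨y, Finset.mem_of_mem_erase hy, hxy⟩⟩
  obtain ⟨t, ht, htc⟩ := (show {s | g s = 0}.Infinite from hinf).exists_subset_card_eq
    (h.toFinset.card + 1 + 1)
  obtain ⟨u, hu, hu0, -⟩ := key _ t (fun s hs => ht hs) htc
  have : u ⊆ h.toFinset := fun x hx => by simpa using hu0 x hx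
  have := Finset.card_le_card this
  omega

/-- Dividing by one exponential makes its term constant, and differentiation removes that term;
Rolle carries finiteness back. Exponents may repeat, so the hypothesis is that the function, not
some coefficient, is nonzero. -/
theorem finite_zeros_sum_exp {ι : Type*} (A : Finset ι) :
    ∀ (c a : ι → ℝ), (∃ s, ∑ i ∈ A, c i * Real.exp (a i * s) ≠ 0) →
      {s | ∑ i ∈ A, c i * Real.exp (a i * s) = 0}.Finite := by
  classical
  induction A using Finset.induction_on with
  | empty => intro c a ⟨s, hs⟩; simp at hs
  | insert b A hb ih =>
    intro c a hne
    set f : ℝ → ℝ := fun s => ∑ i ∈ insert b A, c i * Real.exp (a i * s) with hf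
    set g : ℝ → ℝ := fun s => c b + ∑ i ∈ A, c i * Real.exp ((a i - a b) * s) with hgdef
    set h : ℝ → ℝ := fun s => ∑ i ∈ A, c i * (a i - a b) * Real.exp (a i * s) with hh
    have hfg : ∀ s, f s = Real.exp (a b * s) * g s := by
      intro s
      simp only [hf, hgdef, Finset.sum_insert hb, mul_add, Finset.mul_sum]
      congr 1
      · ring
      · refine Finset.sum_congr rfl fun i _ => ?_
        rw [mul_left_comm, ← Real.exp_add]
        ring_nf
    have hg : ∀ s, HasDerivAt g (Real.exp (-(a b * s)) * h s) s := by
      intro s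
      have : HasDerivAt g (∑ i ∈ A, c i * (Real.exp ((a i - a b) * s) * (a i - a b))) s := by
        refine (HasDerivAt.fun_sum fun i _ => ?_).const_add (c b)
        refine HasDerivAt.const_mul _ (HasDerivAt.exp ?_)
        simpa using (hasDerivAt_id s).const_mul (a i - a b)
      convert this using 1
      simp only [hh, Finset.mul_sum]
      refine Finset.sum_congr rfl fun i _ => ?_
      rw [mul_left_comm, ← Real.exp_add]
      ring_nf
    have hzero : {s | f s = 0} = {s | g s = 0} := by
      ext s
      simp [hfg, (Real.exp_pos _).ne']
    change {s | f s = 0}.Finite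
    rw [hzero]
    by_cases hex : ∃ s, h s ≠ 0
    · refine finite_zeros_of_deriv hg ?_
      convert ih _ _ hex using 3
      simp [hh, (Real.exp_pos _).ne']
    -- Now `g` has zero derivative, so it is a constant, nonzero because `f s₀ ≠ 0`.
    · push Not at hex
      obtain ⟨s₀, hs₀⟩ := hne
      have hconst : ∀ s, g s = g s₀ := fun s =>
        is_const_of_deriv_eq_zero (fun s => (hg s).differentiableAt)
          (fun s => by rw [(hg s).deriv, hex, mul_zero]) s s₀
      have h0 : g s₀ ≠ 0 := by
        intro h0
        apply hs₀
        change f s₀ = 0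
        rw [hfg, h0, mul_zero]
      convert Set.finite_empty (α := ℝ)
      ext s
      simp [hconst s, h0]

/-- A finite sum of real multiples of functions `s ↦ exp (a s)`. -/
def IsExpSum (f : ℝ → ℝ) : Prop :=
  ∃ (ι : Type) (_ : Fintype ι) (c a : ι → ℝ), ∀ s, f s = ∑ i, c i * Real.exp (a i * s)

namespace IsExpSum

theorem exp (a : ℝ) : IsExpSum fun s => Real.exp (a * s) :=
  ⟨Unit, inferInstance, fun _ => 1, fun _ => a, by simp⟩

theorem const (c : ℝ) : IsExpSum fun _ => c :=
  ⟨Unit, inferInstance, fun _ => c, fun _ => 0, by simp⟩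

theorem add {f g : ℝ → ℝ} (hf : IsExpSum f) (hg : IsExpSum g) : IsExpSum fun s => f s + g s := by
  obtain ⟨ι, _, c, a, hf⟩ := hf
  obtain ⟨κ, _, d, b, hg⟩ := hg
  exact ⟨ι ⊕ κ, inferInstance, Sum.elim c d, Sum.elim a b, fun s => by simp [hf, hg]⟩

theorem mul {f g : ℝ → ℝ} (hf : IsExpSum f) (hg : IsExpSum g) : IsExpSum fun s => f s * g s := by
  obtain ⟨ι, _, c, a, hf⟩ := hf
  obtain ⟨κ, _, d, b, hg⟩ := hg
  refine ⟨ι × κ, inferInstance, fun p => c p.1 * d p.2, fun p => a p.1 + b p.2, fun s => ?_⟩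
  simp only [hf, hg]
  rw [Finset.sum_mul_sum, Fintype.sum_prod_type]
  refine Finset.sum_congr rfl fun i _ => Finset.sum_congr rfl fun j _ => ?_
  rw [add_mul, Real.exp_add]
  ring

theorem sub {f g : ℝ → ℝ} (hf : IsExpSum f) (hg : IsExpSum g) : IsExpSum fun s => f s - g s := by
  simpa [sub_eq_add_neg] using hf.add ((const (-1)).mul hg)

theorem finite_zeros {f : ℝ → ℝ} (hf : IsExpSum f) (hne : ∃ s, f s ≠ 0) :
    {s | f s = 0}.Finite := by
  obtain ⟨ι, _, c, a, hf⟩ := hf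
  simp only [hf] at hne ⊢
  exact finite_zeros_sum_exp _ c a hne

end IsExpSum

/-! ### Points of the complex plane and their distances -/

/-- Four times the Gram determinant of three vectors, the first of unit length, where `a`, `c` are
the squared lengths of the others, and `b`, `d`, `e` the squared distances. -/
def gramDet (a b c d e : ℝ) : ℝ :=
  4 * (a * c) + (1 + a - b) * (1 + c - d) * (a + c - e) - (a + c - e) * (a + c - e) -
    a * ((1 + c - d) * (1 + c - d)) - c * ((1 + a - b) * (1 + a - b))

theorem gramDet_eq_zero (y z : ℂ) :
    gramDet (‖y‖ ^ 2) (‖y - 1‖ ^ 2) (‖z‖ ^ 2) (‖z - 1‖ ^ 2) (‖z - y‖ ^ 2) = 0 := by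
  simp only [gramDet, Complex.sq_norm, Complex.normSq_apply, Complex.sub_re, Complex.sub_im,
    Complex.one_re, Complex.one_im]
  ring

/-- Only for finitely many exponents `s` can the powers of five positive numbers be the distances
among four points of the plane whose sixth distance is `1`. -/
theorem finite_exponents (α β γ δ ε : ℝ) :
    {s : ℝ | ∃ y z : ℂ, ‖y‖ = Real.exp (α * s) ∧ ‖y - 1‖ = Real.exp (β * s) ∧
      ‖z‖ = Real.exp (γ * s) ∧ ‖z - 1‖ = Real.exp (δ * s) ∧ ‖z - y‖ = Real.exp (ε * s)}.Finite := by
  have hsq : ∀ a s : ℝ, Real.exp (a * s) ^ 2 = Real.exp (2 * a * s) := fun a s => by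
    rw [← Real.exp_nat_mul]; push_cast; ring_nf
  let e : ℝ → ℝ → ℝ := fun a s => Real.exp (2 * a * s)
  have he : ∀ a, IsExpSum (e a) := fun a => IsExpSum.exp (2 * a)
  have h1 := IsExpSum.const 1
  have hs : ∀ {x y : ℝ}, IsExpSum fun s => 1 + e x s - e y s := ((h1.add (he _)).sub (he _))
  have ht : IsExpSum fun s => e α s + e γ s - e ε s := ((he _).add (he _)).sub (he _)
  have hD : IsExpSum fun s => gramDet (e α s) (e β s) (e γ s) (e δ s) (e ε s) :=
    (((((IsExpSum.const 4).mul ((he α).mul (he γ))).add ((hs.mul hs).mul ht)).sub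
      (ht.mul ht)).sub ((he α).mul (hs.mul hs))).sub ((he γ).mul (hs.mul hs))
  refine (hD.finite_zeros ⟨0, ?_⟩).subset ?_
  -- At `s = 0` all six distances are `1`: a regular tetrahedron, which is not planar.
  · norm_num [gramDet, e]
  · rintro s ⟨y, z, h₁, h₂, h₃, h₄, h₅⟩
    have := gramDet_eq_zero y z
    rw [h₁, h₂, h₃, h₄, h₅] at this
    simp only [hsq] at this
    exact this

theorem eq_or_eq_conj {z w : ℂ} (h₀ : ‖z‖ = ‖w‖) (h₁ : ‖z - 1‖ = ‖w - 1‖) :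
    z = w ∨ z = (starRingEnd ℂ) w := by
  have h₀' : ‖z‖ ^ 2 = ‖w‖ ^ 2 := by rw [h₀]
  have h₁' : ‖z - 1‖ ^ 2 = ‖w - 1‖ ^ 2 := by rw [h₁]
  simp only [Complex.sq_norm, Complex.normSq_apply, Complex.sub_re, Complex.sub_im,
    Complex.one_re, Complex.one_im] at h₀' h₁'
  have hre : z.re = w.re := by linarith
  rw [hre] at h₀'
  rcases mul_self_eq_mul_self_iff.mp (add_left_cancel h₀') with him | him
  · exact Or.inl (Complex.ext hre him)
  · exact Or.inr (Complex.ext (by simpa using hre) (by simpa using him))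

theorem eq_of_im_eq_zero {z w : ℂ} (h₀ : ‖z‖ = ‖w‖) (h₁ : ‖z - 1‖ = ‖w - 1‖) (hw : w.im = 0) :
    z = w := by
  rcases eq_or_eq_conj h₀ h₁ with h | h
  · exact h
  · exact h.trans (Complex.conj_eq_iff_im.mpr hw)

/-- Conjugation preserves the distances from `0` and `1`, but changes the distance from a point off
the real axis unless the conjugated point is real. -/
theorem eq_of_three_norms {y z w : ℂ} (hy : y.im ≠ 0) (h₀ : ‖z‖ = ‖w‖) (h₁ : ‖z - 1‖ = ‖w - 1‖)
    (h₂ : ‖z - y‖ = ‖w - y‖) : z = w := by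
  rcases eq_or_eq_conj h₀ h₁ with h | h
  · exact h
  · refine h.trans (Complex.conj_eq_iff_im.mpr ?_)
    have h₂' : ‖z - y‖ ^ 2 = ‖w - y‖ ^ 2 := by rw [h₂]
    simp only [h, Complex.sq_norm, Complex.normSq_apply, Complex.sub_re, Complex.sub_im,
      Complex.conj_re, Complex.conj_im] at h₂'
    have : y.im * w.im = 0 := by linarith
    exact (mul_eq_zero.mp this).resolve_left hy

/-! ### Cross ratios of probe positions -/

/-- The sheet as the complex plane. -/
noncomputable def toComplex : Sheet ≃ₗᵢ[ℝ] ℂ := Complex.orthonormalBasisOneI.repr.symm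

theorem dist_eq_norm_toComplex (p q : Sheet) : dist p q = ‖toComplex p - toComplex q‖ := by
  rw [← dist_eq_norm, LinearIsometryEquiv.dist_map]

/-- The image of `p` under the Möbius transformation that takes `a`, `b`, `c` to `0`, `1`, `∞`. -/
noncomputable def crossRatio (a b c p : ℂ) : ℂ := (p - a) * (b - c) / ((p - c) * (b - a))

section crossRatio

variable {a b c p r : ℂ}

theorem crossRatio_ne_zero (hba : b ≠ a) (hbc : b ≠ c) (hpa : p ≠ a) (hpc : p ≠ c) :
    crossRatio a b c p ≠ 0 := by
  simp [crossRatio, sub_eq_zero, *]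

theorem crossRatio_sub_one (hba : b ≠ a) (hpc : p ≠ c) :
    crossRatio a b c p - 1 = (p - b) * (c - a) / ((c - p) * (b - a)) := by
  have h₁ := sub_ne_zero.mpr hba
  have h₂ := sub_ne_zero.mpr hpc
  have h₄ := sub_ne_zero.mpr hpc.symm
  rw [crossRatio]
  field_simp
  ring

theorem crossRatio_sub_crossRatio (hba : b ≠ a) (hpc : p ≠ c) (hrc : r ≠ c) :
    crossRatio a b c p - crossRatio a b c r =
      (b - c) / (b - a) * ((p - r) * (a - c) / ((p - c) * (r - c))) := by
  have h₁ := sub_ne_zero.mpr hba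
  have h₂ := sub_ne_zero.mpr hpc
  have h₃ := sub_ne_zero.mpr hrc
  simp only [crossRatio]
  field_simp
  ring

theorem crossRatio_injective (hba : b ≠ a) (hbc : b ≠ c) (hac : a ≠ c) (hpc : p ≠ c) (hrc : r ≠ c)
    (h : crossRatio a b c p = crossRatio a b c r) : p = r := by
  have := crossRatio_sub_crossRatio hba hpc hrc
  rw [h, sub_self] at this
  simpa [sub_eq_zero, hba, hbc, hac, hpc, hrc] using this

/-- The point `b` cancels: the quotient is a cross ratio of `c`, `p`, `a`, `r` alone, so a single
measurement reads its modulus. -/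
theorem crossRatio_sub_div (hba : b ≠ a) (hbc : b ≠ c) (hpc : p ≠ c) (hra : r ≠ a) (hrc : r ≠ c) :
    (crossRatio a b c p - crossRatio a b c r) / crossRatio a b c r =
      (p - r) * (c - a) / ((c - p) * (r - a)) := by
  have h₁ := sub_ne_zero.mpr hba
  have h₂ := sub_ne_zero.mpr hpc
  have h₃ := sub_ne_zero.mpr hrc
  have h₄ := sub_ne_zero.mpr hra
  have h₆ := sub_ne_zero.mpr hpc.symm
  have h₇ := sub_ne_zero.mpr hbc
  rw [crossRatio_sub_crossRatio hba hpc hrc, crossRatio]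
  field_simp
  ring

/-- Four points with a real cross ratio lie on a circle, unless they lie on a line. -/
theorem exists_center_of_crossRatio_im_eq_zero (hba : b ≠ a) (hbc : b ≠ c) (hac : a ≠ c)
    (hpc : p ≠ c) (hline : ((a - c) / (b - c)).im ≠ 0) (h : (crossRatio a b c p).im = 0) :
    ∃ o : ℂ, ‖a - o‖ = ‖o - c‖ ∧ ‖b - o‖ = ‖o - c‖ ∧ ‖p - o‖ = ‖o - c‖ := by
  obtain ⟨t, ht⟩ : ∃ t : ℝ, crossRatio a b c p = t := ⟨_, (Complex.conj_eq_iff_re.mp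
    (Complex.conj_eq_iff_im.mpr h)).symm⟩
  set u := a - c with hu
  set v := b - c with hv
  set w := p - c with hw
  have hu0 : u ≠ 0 := sub_ne_zero.mpr hac
  have hv0 : v ≠ 0 := sub_ne_zero.mpr hbc
  have hw0 : w ≠ 0 := sub_ne_zero.mpr hpc
  have hwt : (w - u) * v = t * (w * (v - u)) := by
    have h₁ := sub_ne_zero.mpr hba
    have h₂ : v - u ≠ 0 := by rw [hv, hu]; simpa using h₁
    rw [crossRatio, show p - a = w - u by rw [hw, hu]; ring,
      show b - a = v - u by rw [hv, hu]; ring, ← hv, ← hw, div_eq_iff (mul_ne_zero hw0 h₂)] at ht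
    exact ht
  have hdet : u.re * v.im - u.im * v.re ≠ 0 := by
    intro hd
    apply hline
    rw [Complex.div_im]
    rw [← sub_div, div_eq_zero_iff]
    left
    linarith
  -- the circumcentre, relative to `c`
  set D := 2 * (u.re * v.im - u.im * v.re) with hD
  have hD0 : D ≠ 0 := mul_ne_zero two_ne_zero hdet
  set g : ℂ := ⟨(v.im * Complex.normSq u - u.im * Complex.normSq v) / D,
    (u.re * Complex.normSq v - v.re * Complex.normSq u) / D⟩ with hg
  have hgre : g.re = (v.im * Complex.normSq u - u.im * Complex.normSq v) / D := rfl
  have hgim : g.im = (u.re * Complex.normSq v - v.re * Complex.normSq u) / D := rfl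
  have crit : ∀ x : ℂ, Complex.normSq x = 2 * (g.re * x.re + g.im * x.im) → ‖x - g‖ = ‖g‖ := by
    intro x hx
    rw [← sq_eq_sq₀ (norm_nonneg _) (norm_nonneg _), Complex.sq_norm, Complex.sq_norm]
    simp only [Complex.normSq_apply, Complex.sub_re, Complex.sub_im] at hx ⊢
    linarith
  have hnu : Complex.normSq u = 2 * (g.re * u.re + g.im * u.im) := by
    rw [hgre, hgim]; field_simp; rw [hD]; ring
  have hnv : Complex.normSq v = 2 * (g.re * v.re + g.im * v.im) := by
    rw [hgre, hgim]; field_simp; rw [hD]; ring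
  -- Inversion at `c` turns the circle through `c` into a line. A real cross ratio `t` says that
  -- `w⁻¹` lies on the line through `u⁻¹` and `v⁻¹`, so `w` lies on the circle.
  have inv_crit : ∀ x : ℂ, x ≠ 0 →
      (Complex.normSq x = 2 * (g.re * x.re + g.im * x.im) ↔ (2 * g * x⁻¹).re = 1) := by
    intro x hx
    have hn : Complex.normSq x ≠ 0 := by simpa using hx
    rw [mul_assoc, show ((2 : ℂ) * (g * x⁻¹)).re = 2 * (g * x⁻¹).re by simp,
      Complex.mul_re, Complex.inv_re, Complex.inv_im]
    field_simp
    constructor <;> intro h <;> linarith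
  have hinv : w⁻¹ = (1 - t) * u⁻¹ + t * v⁻¹ := by
    field_simp
    linear_combination -hwt
  have hnw : Complex.normSq w = 2 * (g.re * w.re + g.im * w.im) := by
    rw [inv_crit w hw0, hinv]
    rw [inv_crit u hu0] at hnu
    rw [inv_crit v hv0] at hnv
    have : 2 * g * ((1 - t) * u⁻¹ + t * v⁻¹) =
        ((1 - t : ℝ) : ℂ) * (2 * g * u⁻¹) + (t : ℂ) * (2 * g * v⁻¹) := by push_cast; ring
    rw [this, Complex.add_re, Complex.re_ofReal_mul, Complex.re_ofReal_mul, hnu, hnv]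
    ring
  refine ⟨g + c, ?_, ?_, ?_⟩
  · rw [add_sub_cancel_right, show a - (g + c) = u - g by rw [hu]; ring]; exact crit u hnu
  · rw [add_sub_cancel_right, show b - (g + c) = v - g by rw [hv]; ring]; exact crit v hnv
  · rw [add_sub_cancel_right, show p - (g + c) = w - g by rw [hw]; ring]; exact crit w hnw

end crossRatio

/-! ### The measurements -/

/-- A probe that is not a reference probe. -/
def newProbe {n : ℕ} (j : Fin (n + 1)) : Fin (n + 4) := j.addNat 3

theorem val_two_probe (n : ℕ) : ((2 : Fin (n + 4)) : ℕ) = 2 :=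
  Nat.mod_eq_of_lt (show 2 < n + 4 by omega)

theorem newProbe_ne {n : ℕ} (j : Fin (n + 1)) :
    newProbe j ≠ 0 ∧ newProbe j ≠ 1 ∧ newProbe j ≠ 2 := by
  simp only [Ne, Fin.ext_iff, newProbe, Fin.val_addNat, Fin.val_zero, Fin.val_one, val_two_probe]
  omega

theorem refProbe_ne {n : ℕ} :
    (1 : Fin (n + 4)) ≠ 0 ∧ (1 : Fin (n + 4)) ≠ 2 ∧ (0 : Fin (n + 4)) ≠ 2 := by
  simp only [Ne, Fin.ext_iff, Fin.val_zero, Fin.val_one, val_two_probe]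
  omega

theorem newProbe_injective {n : ℕ} : Function.Injective (newProbe (n := n)) :=
  fun i j h => by simpa [newProbe, Fin.ext_iff] using h

theorem injective_vec_four {α : Type*} {a b c d : α} (hab : a ≠ b) (hac : a ≠ c) (had : a ≠ d)
    (hbc : b ≠ c) (hbd : b ≠ d) (hcd : c ≠ d) : Function.Injective ![a, b, c, d] := by
  intro i j
  fin_cases i <;> fin_cases j <;>
    simp [hab, hac, had, hbc, hbd, hcd, hab.symm, hac.symm, had.symm, hbc.symm, hbd.symm, hcd.symm]

/-- The cross ratio of a new probe with the three reference probes. -/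
noncomputable def coord {n : ℕ} (P : Fin (n + 4) → Sheet) (j : Fin (n + 1)) : ℂ :=
  crossRatio (toComplex (P 0)) (toComplex (P 1)) (toComplex (P 2)) (toComplex (P (newProbe j)))

/-- The measurement that reads the distance of `coord P j` from `0`. -/
def zeroMeas {n : ℕ} (j : Fin (n + 1)) : FourProbe (n + 4) :=
  ⟨![2, newProbe j, 1, 0],
    injective_vec_four (newProbe_ne j).2.2.symm refProbe_ne.2.1.symm refProbe_ne.2.2.symm
      (newProbe_ne j).2.1 (newProbe_ne j).1 refProbe_ne.1⟩

/-- The measurement that reads the distance of `coord P j` from `1`. -/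
def oneMeas {n : ℕ} (j : Fin (n + 1)) : FourProbe (n + 4) :=
  ⟨![2, newProbe j, 0, 1],
    injective_vec_four (newProbe_ne j).2.2.symm refProbe_ne.2.2.symm refProbe_ne.2.1.symm
      (newProbe_ne j).1 (newProbe_ne j).2.1 refProbe_ne.1.symm⟩

/-- The measurement that compares the distances of `coord P r` from `coord P (r.succAbove i)` and
from `0`. -/
def pairMeas {n : ℕ} (r : Fin (n + 1)) (i : Fin n) : FourProbe (n + 4) :=
  ⟨![2, newProbe (r.succAbove i), 0, newProbe r],
    injective_vec_four (newProbe_ne _).2.2.symm refProbe_ne.2.2.symm (newProbe_ne r).2.2.symm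
      (newProbe_ne _).1 (newProbe_injective.ne (r.succAbove_ne i)) (newProbe_ne r).1.symm⟩

section readings

variable {n : ℕ} {P Q : Fin (n + 4) → Sheet}

theorem toComplex_ne (hP : Function.Injective P) {i j : Fin (n + 4)} (h : i ≠ j) :
    toComplex (P i) ≠ toComplex (P j) := fun e => h (hP (toComplex.injective e))

theorem resistance_zeroMeas (ρ : ℝ) (P : Fin (n + 4) → Sheet) (j : Fin (n + 1)) :
    resistance ρ P (zeroMeas j) = ρ / (2 * Real.pi) * Real.log ‖coord P j‖ := by
  simp only [resistance, zeroMeas, coord, crossRatio, dist_eq_norm_toComplex, norm_mul, norm_div,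
    Function.Embedding.coeFn_mk, Matrix.cons_val]
  rw [norm_sub_rev (toComplex (P 2)) (toComplex (P 1)),
    norm_sub_rev (toComplex (P 2)) (toComplex (P (newProbe j)))]

theorem resistance_oneMeas (ρ : ℝ) (hP : Function.Injective P) (j : Fin (n + 1)) :
    resistance ρ P (oneMeas j) = ρ / (2 * Real.pi) * Real.log ‖coord P j - 1‖ := by
  rw [coord, crossRatio_sub_one (toComplex_ne hP refProbe_ne.1)
    (toComplex_ne hP (newProbe_ne j).2.2)]
  simp only [resistance, oneMeas, dist_eq_norm_toComplex, norm_mul, norm_div,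
    Function.Embedding.coeFn_mk, Matrix.cons_val]
  rw [norm_sub_rev (toComplex (P 0)) (toComplex (P 1))]

theorem resistance_pairMeas (ρ : ℝ) (hP : Function.Injective P) (r : Fin (n + 1)) (i : Fin n) :
    resistance ρ P (pairMeas r i) = ρ / (2 * Real.pi) *
      Real.log ‖(coord P (r.succAbove i) - coord P r) / coord P r‖ := by
  rw [coord, coord, crossRatio_sub_div (toComplex_ne hP refProbe_ne.1)
    (toComplex_ne hP refProbe_ne.2.1) (toComplex_ne hP (newProbe_ne _).2.2)
    (toComplex_ne hP (newProbe_ne r).1) (toComplex_ne hP (newProbe_ne r).2.2)]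
  simp only [resistance, pairMeas, dist_eq_norm_toComplex, norm_mul, norm_div,
    Function.Embedding.coeFn_mk, Matrix.cons_val]
  rw [norm_sub_rev (toComplex (P 0)) (toComplex (P (newProbe r)))]

theorem coord_ne_zero (hP : Function.Injective P) (j : Fin (n + 1)) : coord P j ≠ 0 :=
  crossRatio_ne_zero (toComplex_ne hP refProbe_ne.1) (toComplex_ne hP refProbe_ne.2.1)
    (toComplex_ne hP (newProbe_ne j).1) (toComplex_ne hP (newProbe_ne j).2.2)

theorem coord_sub_one_ne_zero (hP : Function.Injective P) (j : Fin (n + 1)) :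
    coord P j - 1 ≠ 0 := by
  rw [coord, crossRatio_sub_one (toComplex_ne hP refProbe_ne.1)
    (toComplex_ne hP (newProbe_ne j).2.2)]
  simp [sub_eq_zero, toComplex_ne hP refProbe_ne.1, toComplex_ne hP (newProbe_ne j).2.1,
    toComplex_ne hP (newProbe_ne j).2.2.symm, toComplex_ne hP refProbe_ne.2.2.symm]

theorem coord_injective (hP : Function.Injective P) : Function.Injective (coord P) := by
  intro i j h
  exact newProbe_injective (hP (toComplex.injective
    (crossRatio_injective (toComplex_ne hP refProbe_ne.1) (toComplex_ne hP refProbe_ne.2.1)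
      (toComplex_ne hP refProbe_ne.2.2) (toComplex_ne hP (newProbe_ne i).2.2)
      (toComplex_ne hP (newProbe_ne j).2.2) h)))

theorem forall_probe {p : Fin (n + 4) → Prop} (h₀ : p 0) (h₁ : p 1) (h₂ : p 2)
    (h : ∀ j, p (newProbe j)) (i : Fin (n + 4)) : p i := by
  by_cases hi : (i : ℕ) < 3
  · obtain h' | h' | h' : i = 0 ∨ i = 1 ∨ i = 2 := by
      simp only [Fin.ext_iff, Fin.val_zero, Fin.val_one, val_two_probe]
      omega
    all_goals subst h'; assumption
  · have := h ⟨i - 3, by omega⟩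
    rwa [show newProbe (⟨i - 3, by omega⟩ : Fin (n + 1)) = i from
      Fin.ext (by simp only [newProbe, Fin.val_addNat]; omega)] at this

theorem IsPattern.eq_of_coord {Q' : Fin (n + 4) → Sheet} (hQ : IsPattern P Q)
    (hQ' : IsPattern P Q') (h : ∀ j, coord Q j = coord Q' j) : Q = Q' := by
  have h₀ : Q 0 = Q' 0 := (hQ.2 0 (by simp)).trans (hQ'.2 0 (by simp)).symm
  have h₁ : Q 1 = Q' 1 := (hQ.2 1 (by simp)).trans (hQ'.2 1 (by simp)).symm
  have h2 : ((2 : Fin (n + 4)) : ℕ) < 3 := by rw [val_two_probe]; omega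
  have h₂ : Q 2 = Q' 2 := (hQ.2 2 h2).trans (hQ'.2 2 h2).symm
  funext i
  refine forall_probe (p := fun i => Q i = Q' i) h₀ h₁ h₂ (fun j => ?_) i
  have hj := h j
  rw [coord, coord, ← h₀, ← h₁, ← h₂] at hj
  refine toComplex.injective (crossRatio_injective (toComplex_ne hQ.1 refProbe_ne.1)
    (toComplex_ne hQ.1 refProbe_ne.2.1) (toComplex_ne hQ.1 refProbe_ne.2.2)
    (toComplex_ne hQ.1 (newProbe_ne j).2.2) ?_ hj)
  rw [h₂]
  exact toComplex_ne hQ'.1 (newProbe_ne j).2.2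

/-- Source of the exponent `ρ / σ`, common to all measurements. -/
theorem eq_exp_of_log {σ ρ x y : ℝ} (hσ : 0 < σ) (hx : 0 < x)
    (h : σ / (2 * Real.pi) * Real.log x = ρ / (2 * Real.pi) * Real.log y) :
    x = Real.exp (Real.log y * (ρ / σ)) := by
  rw [← Real.exp_log hx]
  congr 1
  have := Real.pi_pos
  field_simp at h ⊢
  simpa [mul_comm] using h

variable {σ ρ : ℝ}

theorem norm_coord (hσ : 0 < σ) (hQ : Function.Injective Q) {j : Fin (n + 1)}
    (h : resistance σ Q (zeroMeas j) = resistance ρ P (zeroMeas j)) :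
    ‖coord Q j‖ = Real.exp (Real.log ‖coord P j‖ * (ρ / σ)) := by
  rw [resistance_zeroMeas, resistance_zeroMeas] at h
  exact eq_exp_of_log hσ (norm_pos_iff.mpr (coord_ne_zero hQ j)) h

theorem norm_coord_sub_one (hσ : 0 < σ) (hP : Function.Injective P) (hQ : Function.Injective Q)
    {j : Fin (n + 1)} (h : resistance σ Q (oneMeas j) = resistance ρ P (oneMeas j)) :
    ‖coord Q j - 1‖ = Real.exp (Real.log ‖coord P j - 1‖ * (ρ / σ)) := by
  rw [resistance_oneMeas σ hQ, resistance_oneMeas ρ hP] at h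
  exact eq_exp_of_log hσ (norm_pos_iff.mpr (coord_sub_one_ne_zero hQ j)) h

/-- The pair measurement reads the distance only relative to `‖coord P r‖`; the zero measurement of
`r` supplies the missing factor, with the same exponent. -/
theorem norm_coord_sub_coord (hσ : 0 < σ) (hP : Function.Injective P) (hQ : Function.Injective Q)
    {r : Fin (n + 1)} {i : Fin n}
    (h : resistance σ Q (pairMeas r i) = resistance ρ P (pairMeas r i))
    (hr : resistance σ Q (zeroMeas r) = resistance ρ P (zeroMeas r)) :
    ‖coord Q (r.succAbove i) - coord Q r‖ =
      Real.exp (Real.log ‖coord P (r.succAbove i) - coord P r‖ * (ρ / σ)) := by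
  have hne : ∀ {P : Fin (n + 4) → Sheet}, Function.Injective P →
      coord P (r.succAbove i) - coord P r ≠ 0 := fun hP =>
    sub_ne_zero.mpr fun h => r.succAbove_ne i (coord_injective hP h)
  rw [resistance_pairMeas σ hQ, resistance_pairMeas ρ hP] at h
  have h' := eq_exp_of_log hσ
    (norm_pos_iff.mpr (div_ne_zero (hne hQ) (coord_ne_zero hQ r))) h
  rw [norm_div, norm_div, div_eq_iff (norm_ne_zero_iff.mpr (coord_ne_zero hQ r)),
    norm_coord hσ hQ hr, ← Real.exp_add, Real.log_div (norm_ne_zero_iff.mpr (hne hP))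
      (norm_ne_zero_iff.mpr (coord_ne_zero hP r))] at h'
  rw [h']
  ring_nf

theorem exp_log_mul_self_div {x : ℝ} (hρ : 0 < ρ) (hx : 0 < x) :
    Real.exp (Real.log x * (ρ / ρ)) = x := by
  rw [div_self hρ.ne', mul_one, Real.exp_log hx]

theorem norm_coord_eq (hρ : 0 < ρ) (hP : Function.Injective P) (hQ : Function.Injective Q)
    {j : Fin (n + 1)} (h : resistance ρ Q (zeroMeas j) = resistance ρ P (zeroMeas j)) :
    ‖coord Q j‖ = ‖coord P j‖ := by
  rw [norm_coord hρ hQ h, exp_log_mul_self_div hρ (norm_pos_iff.mpr (coord_ne_zero hP j))]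

theorem norm_coord_sub_one_eq (hρ : 0 < ρ) (hP : Function.Injective P)
    (hQ : Function.Injective Q) {j : Fin (n + 1)}
    (h : resistance ρ Q (oneMeas j) = resistance ρ P (oneMeas j)) :
    ‖coord Q j - 1‖ = ‖coord P j - 1‖ := by
  rw [norm_coord_sub_one hρ hP hQ h,
    exp_log_mul_self_div hρ (norm_pos_iff.mpr (coord_sub_one_ne_zero hP j))]

theorem norm_coord_sub_coord_eq (hρ : 0 < ρ) (hP : Function.Injective P)
    (hQ : Function.Injective Q) {r : Fin (n + 1)} {i : Fin n}
    (h : resistance ρ Q (pairMeas r i) = resistance ρ P (pairMeas r i))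
    (hr : resistance ρ Q (zeroMeas r) = resistance ρ P (zeroMeas r)) :
    ‖coord Q (r.succAbove i) - coord Q r‖ = ‖coord P (r.succAbove i) - coord P r‖ := by
  rw [norm_coord_sub_coord hρ hP hQ h hr, exp_log_mul_self_div hρ (norm_pos_iff.mpr ?_)]
  exact sub_ne_zero.mpr fun h => r.succAbove_ne i (coord_injective hP h)

theorem NoThreeCollinear.injective (h : NoThreeCollinear P) : Function.Injective P := by
  intro i j hij
  by_contra hne
  have hcard : ({i, j} : Finset (Fin (n + 4))).card < (Finset.univ : Finset (Fin (n + 4))).card :=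
    (Finset.card_le_two).trans_lt (by simp)
  obtain ⟨k, -, hk⟩ := Finset.exists_mem_notMem_of_card_lt_card hcard
  simp only [Finset.mem_insert, Finset.mem_singleton, not_or] at hk
  refine h i j k hne (Ne.symm hk.1) (Ne.symm hk.2) ?_
  rw [hij, Set.insert_eq_of_mem (by simp)]
  exact collinear_pair ℝ _ _

theorem NoThreeCollinear.im_ne_zero (h : NoThreeCollinear P) :
    ((toComplex (P 0) - toComplex (P 2)) / (toComplex (P 1) - toComplex (P 2))).im ≠ 0 := by
  intro him
  have h12 := sub_ne_zero.mpr (toComplex_ne h.injective (refProbe_ne (n := n)).2.1)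
  obtain ⟨t, ht⟩ : ∃ t : ℝ, (toComplex (P 0) - toComplex (P 2)) /
      (toComplex (P 1) - toComplex (P 2)) = t :=
    ⟨_, (Complex.conj_eq_iff_re.mp (Complex.conj_eq_iff_im.mpr him)).symm⟩
  rw [div_eq_iff h12] at ht
  refine h 0 1 2 refProbe_ne.1.symm refProbe_ne.2.2 refProbe_ne.2.1 ?_
  rw [collinear_iff_of_mem (p₀ := P 2) (by simp)]
  refine ⟨P 1 - P 2, ?_⟩
  simp only [Set.mem_insert_iff, Set.mem_singleton_iff, forall_eq_or_imp, forall_eq, vadd_eq_add]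
  refine ⟨⟨t, toComplex.injective ?_⟩, ⟨1, by simp⟩, ⟨0, by simp⟩⟩
  rw [map_add, map_smul, map_sub, Complex.real_smul, ← ht, sub_add_cancel]

/-- A real cross ratio means four concyclic probes. -/
theorem NoThreeCollinear.cospherical (h : NoThreeCollinear P) (him : (coord P 0).im = 0) :
    EuclideanGeometry.Cospherical (P '' {i : Fin (n + 4) | (i : ℕ) < 4}) := by
  have hP := h.injective
  obtain ⟨o, ho₀, ho₁, ho₃⟩ := exists_center_of_crossRatio_im_eq_zero
    (toComplex_ne hP refProbe_ne.1) (toComplex_ne hP refProbe_ne.2.1)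
    (toComplex_ne hP refProbe_ne.2.2) (toComplex_ne hP (newProbe_ne 0).2.2) h.im_ne_zero him
  refine ⟨toComplex.symm o, ‖o - toComplex (P 2)‖, ?_⟩
  rintro _ ⟨i, hi, rfl⟩
  rw [dist_eq_norm_toComplex, LinearIsometryEquiv.apply_symm_apply]
  revert hi
  refine forall_probe (p := fun i => (i : ℕ) < 4 → ‖toComplex (P i) - o‖ = _)
    (fun _ => ho₀) (fun _ => ho₁) (fun _ => norm_sub_rev _ _) (fun j hj => ?_) i
  have : j = 0 := by
    simp only [newProbe, Fin.val_addNat] at hj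
    exact Fin.ext (by simp only [Fin.val_zero]; omega)
  rw [this]
  exact ho₃

/-! ### Counting the patterns -/

theorem encard_le_two_of_injOn (r : Fin (n + 1)) {𝒮 : Set (Fin (n + 4) → Sheet)}
    (hinj : Set.InjOn (fun Q => coord Q r) 𝒮)
    (h : ∀ Q ∈ 𝒮, ‖coord Q r‖ = ‖coord P r‖ ∧ ‖coord Q r - 1‖ = ‖coord P r - 1‖) :
    𝒮.encard ≤ 2 := by
  rw [← hinj.encard_image]
  refine (Set.encard_le_encard (t := {coord P r, (starRingEnd ℂ) (coord P r)}) ?_).trans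
    ((Set.encard_insert_le _ _).trans (by rw [Set.encard_singleton]; norm_num))
  rintro _ ⟨Q, hQ, rfl⟩
  exact eq_or_eq_conj (h Q hQ).1 (h Q hQ).2

/-- If `coord P r` is not real, its two possible values determine the other coordinates. -/
theorem injOn_coord {r : Fin (n + 1)} (hr : (coord P r).im ≠ 0) {𝒮 : Set (Fin (n + 4) → Sheet)}
    (hpat : ∀ Q ∈ 𝒮, IsPattern P Q)
    (h : ∀ Q ∈ 𝒮, ∀ j, ‖coord Q j‖ = ‖coord P j‖ ∧ ‖coord Q j - 1‖ = ‖coord P j - 1‖)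
    (hpair : ∀ Q ∈ 𝒮, ∀ i, ‖coord Q (r.succAbove i) - coord Q r‖ =
      ‖coord P (r.succAbove i) - coord P r‖) :
    Set.InjOn (fun Q => coord Q r) 𝒮 := by
  intro Q hQ Q' hQ' heq
  simp only at heq
  refine (hpat Q hQ).eq_of_coord (hpat Q' hQ') fun j => ?_
  rcases eq_or_ne j r with rfl | hj
  · exact heq
  · obtain ⟨i, rfl⟩ := Fin.exists_succAbove_eq hj
    have him : (coord Q' r).im ≠ 0 := by
      rcases eq_or_eq_conj (h Q' hQ' r).1 (h Q' hQ' r).2 with e | e <;> simpa [e] using hr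
    refine eq_of_three_norms him ((h Q hQ _).1.trans (h Q' hQ' _).1.symm)
      ((h Q hQ _).2.trans (h Q' hQ' _).2.symm) ?_
    rw [hpair Q' hQ', ← hpair Q hQ, heq]

/-! ### One set of measurements for all positions -/

/-- The measurements that determine the patterns when they do not depend on the readings. -/
def fixedMeas (n : ℕ) : Fin (n + 1) ⊕ Fin (n + 1) ⊕ Fin n → FourProbe (n + 4)
  | .inl j => zeroMeas j
  | .inr (.inl j) => oneMeas j
  | .inr (.inr i) => pairMeas 0 i

theorem fixedMeas_injective (n : ℕ) : Function.Injective (fixedMeas n) := by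
  rintro (i | i | i) (j | j | j) h
  all_goals
    have h₁ := DFunLike.congr_fun h 1
    have h₂ := DFunLike.congr_fun h 2
    have h₃ := DFunLike.congr_fun h 3
    simp only [fixedMeas, zeroMeas, oneMeas, pairMeas, Function.Embedding.coeFn_mk,
      Matrix.cons_val] at h₁ h₂ h₃
  · rw [newProbe_injective h₁]
  · exact absurd h₂ refProbe_ne.1
  · exact absurd h₂ refProbe_ne.1
  · exact absurd h₂.symm refProbe_ne.1
  · rw [newProbe_injective h₁]
  · exact absurd h₃.symm (newProbe_ne 0).2.1
  · exact absurd h₂.symm refProbe_ne.1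
  · exact absurd h₃ (newProbe_ne 0).2.1
  · rw [Fin.succAbove_right_injective (newProbe_injective h₁)]

theorem encard_patterns_le_two (hρ : 0 < ρ) (hP : NoThreeCollinear P)
    (hc : 2 ≤ n → ¬ EuclideanGeometry.Cospherical (P '' {i : Fin (n + 4) | (i : ℕ) < 4})) :
    {Q | IsPattern P Q ∧ ∀ x, resistance ρ Q (fixedMeas n x) =
      resistance ρ P (fixedMeas n x)}.encard ≤ 2 := by
  set 𝒮 := {Q | IsPattern P Q ∧ ∀ x, resistance ρ Q (fixedMeas n x) =
    resistance ρ P (fixedMeas n x)}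
  have hpat : ∀ Q ∈ 𝒮, IsPattern P Q := fun Q hQ => hQ.1
  have h : ∀ Q ∈ 𝒮, ∀ j, ‖coord Q j‖ = ‖coord P j‖ ∧ ‖coord Q j - 1‖ = ‖coord P j - 1‖ :=
    fun Q hQ j => ⟨norm_coord_eq hρ hP.injective hQ.1.1 (hQ.2 (.inl j)),
      norm_coord_sub_one_eq hρ hP.injective hQ.1.1 (hQ.2 (.inr (.inl j)))⟩
  by_cases him : (coord P 0).im = 0
  · have hn : n ≤ 1 := by
      by_contra hn
      exact hc (by omega) (hP.cospherical him)
    -- Coordinate `0` is real, hence determined, and at most one other is left.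
    refine encard_le_two_of_injOn (Fin.last n) ?_ fun Q hQ => h Q hQ _
    intro Q hQ Q' hQ' heq
    refine hQ.1.eq_of_coord hQ'.1 fun j => ?_
    obtain rfl | rfl : j = 0 ∨ j = Fin.last n := by
      simp only [Fin.ext_iff, Fin.val_zero, Fin.val_last]
      omega
    · rw [eq_of_im_eq_zero (h Q hQ 0).1 (h Q hQ 0).2 him,
        eq_of_im_eq_zero (h Q' hQ' 0).1 (h Q' hQ' 0).2 him]
    · exact heq
  · exact encard_le_two_of_injOn 0 (injOn_coord him hpat h fun Q hQ i =>
      norm_coord_sub_coord_eq hρ hP.injective hQ.1.1 (hQ.2 (.inr (.inr i))) (hQ.2 (.inl 0)))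
      fun Q hQ => h Q hQ _

/-- Any two candidates for the same `σ` agree coordinatewise up to conjugation. The comparison is
with some candidate `Q₀`, since `P` itself need not be one when `σ ≠ ρ`. -/
theorem finite_patterns (hσ : 0 < σ) (hP : Function.Injective P) :
    {Q | IsPattern P Q ∧ ∀ x, resistance σ Q (fixedMeas n x) =
      resistance ρ P (fixedMeas n x)}.Finite := by
  rcases Set.eq_empty_or_nonempty {Q | IsPattern P Q ∧ ∀ x, resistance σ Q (fixedMeas n x) =
    resistance ρ P (fixedMeas n x)} with he | ⟨Q₀, hQ₀⟩
  · rw [he]; exact Set.finite_empty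
  refine Set.Finite.of_finite_image (f := coord) ((Set.Finite.pi' (t := fun j =>
    {coord Q₀ j, (starRingEnd ℂ) (coord Q₀ j)}) fun j => Set.toFinite _).subset ?_) ?_
  · rintro _ ⟨Q, hQ, rfl⟩ j
    refine eq_or_eq_conj ?_ ?_
    · rw [norm_coord hσ hQ.1.1 (hQ.2 (.inl j)), norm_coord hσ hQ₀.1.1 (hQ₀.2 (.inl j))]
    · rw [norm_coord_sub_one hσ hP hQ.1.1 (hQ.2 (.inr (.inl j))),
        norm_coord_sub_one hσ hP hQ₀.1.1 (hQ₀.2 (.inr (.inl j)))]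
  · intro Q hQ Q' hQ' heq
    exact hQ.1.eq_of_coord hQ'.1 (congrFun heq)

theorem finite_resistance_patterns (hn : 1 ≤ n) (hρ : 0 < ρ) (hP : Function.Injective P) :
    {x : ℝ × (Fin (n + 4) → Sheet) | 0 < x.1 ∧ IsPattern P x.2 ∧
      ∀ y, resistance x.1 x.2 (fixedMeas n y) = resistance ρ P (fixedMeas n y)}.Finite := by
  set 𝒯 := {x : ℝ × (Fin (n + 4) → Sheet) | 0 < x.1 ∧ IsPattern P x.2 ∧
    ∀ y, resistance x.1 x.2 (fixedMeas n y) = resistance ρ P (fixedMeas n y)}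
  set i : Fin n := ⟨0, hn⟩
  have hfst : (Prod.fst '' 𝒯).Finite := by
    refine ((finite_exponents (Real.log ‖coord P 0‖) (Real.log ‖coord P 0 - 1‖)
      (Real.log ‖coord P (Fin.succAbove 0 i)‖) (Real.log ‖coord P (Fin.succAbove 0 i) - 1‖)
      (Real.log ‖coord P (Fin.succAbove 0 i) - coord P 0‖)).image fun s => ρ / s).subset ?_
    rintro _ ⟨⟨σ, Q⟩, ⟨hσ, hQ, hR⟩, rfl⟩
    simp only at hσ hQ hR ⊢
    refine ⟨ρ / σ, ⟨coord Q 0, coord Q (Fin.succAbove 0 i), ?_, ?_, ?_, ?_, ?_⟩, ?_⟩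
    · exact norm_coord hσ hQ.1 (hR (.inl _))
    · exact norm_coord_sub_one hσ hP hQ.1 (hR (.inr (.inl _)))
    · exact norm_coord hσ hQ.1 (hR (.inl _))
    · exact norm_coord_sub_one hσ hP hQ.1 (hR (.inr (.inl _)))
    · exact norm_coord_sub_coord hσ hP hQ.1 (hR (.inr (.inr i))) (hR (.inl _))
    · exact div_div_cancel₀ hρ.ne'
  refine Set.Finite.of_finite_fibers Prod.fst hfst ?_
  rintro _ ⟨⟨σ, Q₀⟩, ⟨hσ, -⟩, rfl⟩
  refine ((finite_patterns (ρ := ρ) hσ hP).image (Prod.mk σ)).subset ?_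
  rintro ⟨τ, Q⟩ ⟨hQ, rfl⟩
  exact ⟨Q, hQ.2, rfl⟩

end readings

/-! ### Measurements that depend on the earlier readings -/

theorem length_readings {N : ℕ} (S : List ℝ → FourProbe N) (R : FourProbe N → ℝ) (m : ℕ) :
    (readings S R m).length = m := by
  induction m with
  | zero => rfl
  | succ m ih => simp [readings, ih]

theorem drop_readings {N : ℕ} (S : List ℝ → FourProbe N) (R : FourProbe N → ℝ) (m k : ℕ) :
    (readings S R (m + k)).drop k = readings S R m := by
  induction k with
  | zero => simp
  | succ k ih => simpa [readings, ← add_assoc] using ih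

theorem readings_eq_of_le {N : ℕ} {S : List ℝ → FourProbe N} {R R' : FourProbe N → ℝ} {m : ℕ}
    (h : readings S R m = readings S R' m) {k : ℕ} (hk : k ≤ m) :
    readings S R k = readings S R' k := by
  obtain ⟨d, rfl⟩ := Nat.exists_eq_add_of_le hk
  rw [← drop_readings S R k d, h, drop_readings]

/-- Equal histories make the rule choose the same measurement, so equal readings compare like with
like. -/
theorem reading_eq_of_lt {N : ℕ} {S : List ℝ → FourProbe N} {R R' : FourProbe N → ℝ} {m : ℕ}
    (h : readings S R m = readings S R' m) {k : ℕ} (hk : k < m) :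
    R (S (readings S R k)) = R' (S (readings S R k)) := by
  have h' := readings_eq_of_le h (Nat.succ_le_of_lt hk)
  rw [readings, readings, ← readings_eq_of_le h hk.le] at h'
  exact (List.cons.inj h').1

theorem readings_congr {N : ℕ} {S S' : List ℝ → FourProbe N} {R : FourProbe N → ℝ} {m : ℕ}
    (h : ∀ L : List ℝ, L.length < m → S L = S' L) : readings S R m = readings S' R m := by
  induction m with
  | zero => rfl
  | succ m ih =>
    rw [readings, readings, ih fun L hL => h L (by omega), h _ (by rw [length_readings]; omega)]

/-- The `m`-th measurement: the distances of all coordinates from `0`, then from `1`, then from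
the coordinate with the index `r`. -/
def schedule {n : ℕ} (r : Fin (n + 1)) (m : ℕ) : FourProbe (n + 4) :=
  if h : m < n + 1 then zeroMeas ⟨m, h⟩
  else if h : m - (n + 1) < n + 1 then oneMeas ⟨m - (n + 1), h⟩
  else if h : m - 2 * (n + 1) < n then pairMeas r ⟨m - 2 * (n + 1), h⟩
  -- Never reached among the `2(n + 1) + n` measurements taken.
  else zeroMeas 0

section adaptive

variable {n : ℕ}

theorem schedule_zeroMeas (r : Fin (n + 1)) (j : Fin (n + 1)) :
    schedule r (j : ℕ) = zeroMeas j := by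
  rw [schedule, dif_pos j.isLt]

theorem schedule_oneMeas (r : Fin (n + 1)) (j : Fin (n + 1)) :
    schedule r (n + 1 + j : ℕ) = oneMeas j := by
  have h : ¬ n + 1 + (j : ℕ) < n + 1 := by omega
  have h' : n + 1 + (j : ℕ) - (n + 1) < n + 1 := by omega
  rw [schedule, dif_neg h, dif_pos h']
  simp only [Nat.add_sub_cancel_left]

theorem schedule_pairMeas (r : Fin (n + 1)) (i : Fin n) :
    schedule r (2 * (n + 1) + i : ℕ) = pairMeas r i := by
  have h₁ : ¬ 2 * (n + 1) + (i : ℕ) < n + 1 := by omega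
  have h₂ : ¬ 2 * (n + 1) + (i : ℕ) - (n + 1) < n + 1 := by omega
  simp [schedule, h₁, h₂]

theorem schedule_eq_of_lt (r r' : Fin (n + 1)) {m : ℕ} (hm : m < 2 * (n + 1)) :
    schedule r m = schedule r' m := by
  unfold schedule
  split_ifs with h₁ h₂ h₃
  · rfl
  · rfl
  · omega
  · rfl

/-- The readings of the measurements that do not depend on earlier readings. -/
noncomputable def initialReadings (ρ : ℝ) (P : Fin (n + 4) → Sheet) : List ℝ :=
  readings (fun L => schedule (0 : Fin (n + 1)) L.length) (resistance ρ P) (2 * (n + 1))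

open Classical in
/-- A coordinate that is not real, as far as the initial readings `L` show one. -/
noncomputable def pivot (n : ℕ) (ρ : ℝ) (L : List ℝ) : Fin (n + 1) :=
  if h : ∃ r : Fin (n + 1), ∀ P : Fin (n + 4) → Sheet, Function.Injective P →
    initialReadings ρ P = L → (coord P r).im ≠ 0 then h.choose else 0

/-- The rule that chooses the next measurement. -/
noncomputable def rule (n : ℕ) (ρ : ℝ) (L : List ℝ) : FourProbe (n + 4) :=
  -- The latest reading comes first, so dropping leaves the oldest `2(n + 1)` readings. Before these
  -- are complete the pivot is meaningless, but `schedule` does not use it yet.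
  schedule (pivot n ρ (L.drop (L.length - 2 * (n + 1)))) L.length

variable {ρ : ℝ} {P Q : Fin (n + 4) → Sheet}

theorem norms_of_initialReadings (hρ : 0 < ρ) (hP : Function.Injective P)
    (hQ : Function.Injective Q) (h : initialReadings ρ Q = initialReadings ρ P)
    (j : Fin (n + 1)) : ‖coord Q j‖ = ‖coord P j‖ ∧ ‖coord Q j - 1‖ = ‖coord P j - 1‖ := by
  have key : ∀ m < 2 * (n + 1), resistance ρ Q (schedule (0 : Fin (n + 1)) m) =
      resistance ρ P (schedule 0 m) := fun m hm => by
    simpa only [length_readings] using reading_eq_of_lt h hm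
  constructor
  · have := key j (by omega)
    rw [schedule_zeroMeas] at this
    exact norm_coord_eq hρ hP hQ this
  · have := key (n + 1 + j) (by omega)
    rw [schedule_oneMeas] at this
    exact norm_coord_sub_one_eq hρ hP hQ this

/-- The initial readings fix each coordinate up to conjugation, so whether it is real depends on
them alone; a nonreal `coord P j` is thus a valid choice for the pivot. -/
theorem im_coord_pivot (hρ : 0 < ρ) (hP : Function.Injective P) (j : Fin (n + 1))
    (hj : (coord P j).im ≠ 0) : (coord P (pivot n ρ (initialReadings ρ P))).im ≠ 0 := by
  have hex : ∃ r : Fin (n + 1), ∀ Q : Fin (n + 4) → Sheet, Function.Injective Q →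
      initialReadings ρ Q = initialReadings ρ P → (coord Q r).im ≠ 0 := by
    refine ⟨j, fun Q hQ h => ?_⟩
    have := norms_of_initialReadings hρ hP hQ h j
    rcases eq_or_eq_conj this.1 this.2 with e | e <;> simpa [e] using hj
  rw [pivot, dif_pos hex]
  exact hex.choose_spec P hP rfl

theorem readings_rule (ρ : ℝ) (P : Fin (n + 4) → Sheet) :
    readings (rule n ρ) (resistance ρ P) (2 * (n + 1)) = initialReadings ρ P :=
  readings_congr fun _ hL => schedule_eq_of_lt _ _ hL

theorem rule_readings_add (ρ : ℝ) (P : Fin (n + 4) → Sheet) (i : Fin n) :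
    rule n ρ (readings (rule n ρ) (resistance ρ P) (2 * (n + 1) + i)) =
      pairMeas (pivot n ρ (initialReadings ρ P)) i := by
  rw [rule, length_readings, Nat.add_sub_cancel_left, drop_readings, readings_rule,
    schedule_pairMeas]

theorem encard_patterns_rule_le_two (hρ : 0 < ρ) (hP : Function.Injective P) :
    {Q | IsPattern P Q ∧ readings (rule n ρ) (resistance ρ Q) (2 * (n + 1) + n) =
      readings (rule n ρ) (resistance ρ P) (2 * (n + 1) + n)}.encard ≤ 2 := by
  set 𝒮 := {Q | IsPattern P Q ∧ readings (rule n ρ) (resistance ρ Q) (2 * (n + 1) + n) =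
    readings (rule n ρ) (resistance ρ P) (2 * (n + 1) + n)}
  have hpat : ∀ Q ∈ 𝒮, IsPattern P Q := fun Q hQ => hQ.1
  have hinit : ∀ Q ∈ 𝒮, initialReadings ρ Q = initialReadings ρ P := fun Q hQ => by
    rw [← readings_rule, ← readings_rule]
    exact readings_eq_of_le hQ.2 (by omega)
  have h : ∀ Q ∈ 𝒮, ∀ j, ‖coord Q j‖ = ‖coord P j‖ ∧ ‖coord Q j - 1‖ = ‖coord P j - 1‖ :=
    fun Q hQ => norms_of_initialReadings hρ hP hQ.1.1 (hinit Q hQ)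
  refine encard_le_two_of_injOn (pivot n ρ (initialReadings ρ P)) ?_ fun Q hQ => h Q hQ _
  by_cases hex : ∃ j, (coord P j).im ≠ 0
  · obtain ⟨j, hj⟩ := hex
    refine injOn_coord (im_coord_pivot hρ hP j hj) hpat h fun Q hQ i => ?_
    have hi := reading_eq_of_lt hQ.2 (k := 2 * (n + 1) + i) (by omega)
    -- The pivot seen from `Q` is that of `P`, because the initial readings agree.
    rw [rule_readings_add, hinit Q hQ] at hi
    refine norm_coord_sub_coord_eq hρ hP hQ.1.1 hi ?_
    rw [resistance_zeroMeas, resistance_zeroMeas, (h Q hQ _).1]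
  -- All coordinates are real, so their distances from `0` and `1` already determine them.
  · push Not at hex
    intro Q hQ Q' hQ' _
    refine hQ.1.eq_of_coord hQ'.1 fun j => ?_
    rw [eq_of_im_eq_zero (h Q hQ j).1 (h Q hQ j).2 (hex j),
      eq_of_im_eq_zero (h Q' hQ' j).1 (h Q' hQ' j).2 (hex j)]

end adaptive

theorem theorem2 (N : ℕ) (hN : 4 ≤ N) :
    -- One set of `2 + 3(N - 4)` measurements, which depends on `N` only.
    (∃ M : Finset (FourProbe N), M.card = 2 + 3 * (N - 4) ∧
      ∀ (ρ : ℝ) (P : Fin N → Sheet), 0 < ρ → NoThreeCollinear P →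
        -- Known sheet resistance: at most two patterns.  For `N ≥ 6` the fourth probe must not
        -- lie on the circle through the three reference probes.
        ((6 ≤ N → ¬ EuclideanGeometry.Cospherical (P '' {i : Fin N | (i : ℕ) < 4})) →
          {Q : Fin N → Sheet | IsPattern P Q ∧
            ∀ q ∈ M, resistance ρ Q q = resistance ρ P q}.encard ≤ 2) ∧
        -- Unknown sheet resistance: finitely many candidates for it and the positions.
        (5 ≤ N →
          {x : ℝ × (Fin N → Sheet) | 0 < x.1 ∧ IsPattern P x.2 ∧
            ∀ q ∈ M, resistance x.1 x.2 q = resistance ρ P q}.Finite)) ∧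
    -- Known sheet resistance, no exception: `2 + 3(N - 4)` measurements, chosen one after
    -- another from the readings so far, leave at most two patterns.
    (∀ ρ : ℝ, 0 < ρ → ∃ S : List ℝ → FourProbe N,
      ∀ P : Fin N → Sheet, NoThreeCollinear P →
        {Q : Fin N → Sheet | IsPattern P Q ∧
          readings S (resistance ρ Q) (2 + 3 * (N - 4)) =
            readings S (resistance ρ P) (2 + 3 * (N - 4))}.encard ≤ 2) := by

  obtain ⟨n, rfl⟩ := Nat.exists_eq_add_of_le' hN
  rw [Nat.add_sub_cancel]
  refine ⟨⟨Finset.univ.map ⟨fixedMeas n, fixedMeas_injective n⟩, ?_, fun ρ P hρ hP => ⟨?_, ?_⟩⟩,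
    fun ρ hρ => ⟨rule n ρ, fun P hP => ?_⟩⟩
  · simp only [Finset.card_map, Finset.card_univ, Fintype.card_sum, Fintype.card_fin]
    ring
  · intro hc
    simpa only [Finset.forall_mem_map, Finset.mem_univ, forall_const, Function.Embedding.coeFn_mk] using
      encard_patterns_le_two hρ hP fun hn => hc (by omega)
  · intro hn
    simpa only [Finset.forall_mem_map, Finset.mem_univ, forall_const, Function.Embedding.coeFn_mk] using
      finite_resistance_patterns (by omega) hρ hP.injective
  · rw [show 2 + 3 * n = 2 * (n + 1) + n by ring]
    exact encard_patterns_rule_le_two hρ hP.injective
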